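/- Let $m:\mathbb R^n\to\mathbb R$ be the prior mean function and $\kappa:\mathbb R^n\times\mathbb R^n\to\mathbb R$ the prior covariance function (kernel: all Gram matrices are symmetric positive semidefinite) of a Gaussian process. Let $\ell\ge 1$, let $X^d=(x^d_1,\dots,x^d_\ell)\in\mathbb R^{\ell\times n}$ be past evaluation points with $K(X^d,X^d)$ invertible, where $K(X,Z)=(\kappa(X_i,Z_j))_{i,j}$ and $X_i$ denotes the $i$-th row of $X$, let $y^d\in\mathbb R^\ell$ be the observed (noiseless) values, and let $\underline{y^d}=\min_j y^d_j$. For a batch $X\in\mathbb R^{k\times n}$ let $$\mu(X)=m(X)+K(X,X^d)K(X^d,X^d)^{-1}\bigl(y^d-m(X^d)\bigr),$$ $$\Sigma(X)=K(X,X)-K(X,X^d)K(X^d,X^d)^{-1}K(X^d,X)$$ be the posterior mean and covariance, and let $$\Omega(X)=\begin{bmatrix}\Sigma(X)+\mu(X)\mu(X)^T & \mu(X)\\ \mu(X)^T & 1\end{bmatrix}.$$ For a $(k+1)\times(k+1)$ matrix $\Omega$ let $$p(\Omega)=\sup\{\langle\Omega,M\rangle : M\in\mathbb S^{k+1},\ M-C_i\preceq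 0,\ i=0,\dots,k\},$$ where $C_0=0$ and $$C_i=\begin{bmatrix}0&e_i/2\\ e_i^T/2&-\underline{y^d}\end{bmatrix},\qquad i=1,\dots,k.$$ The optimistic expected improvement acquisition function is $\bar\alpha(X)=p(\Omega(X))$. Here a function is called twice differentiable at a point if it is differentiable in a neighbourhood of that point and its (Fréchet) derivative is differentiable at the point. Let $X\in\mathbb R^{k\times n}$ be a batch with $\Sigma(X)\succ 0$ such that $m$ is twice differentiable at every row $X_i$ and $\kappa$ is twice differentiable at all pairs $(X_i,X_j)$ and $(X_i,x^d_j)$. Then the supremum defining $\bar\alpha(X)$ is finite, and $\bar\alpha$ is twice differentiable at $X$. In particular, if $m$ and $\kappa$ are twice differentiable everywhere, then $\bar\alpha$ is twice differentiable at every $X$ with $\Sigma(X)\succ 0$. -/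

import Mathlib

open scoped Matrix Topology

namespace OEI

/-- A real function is twice (Fréchet) differentiable at `x` if it is differentiable in a
neighbourhood of `x` and its derivative is differentiable at `x`. -/
def TwiceDifferentiableAt {E : Type*} [NormedAddCommGroup E] [NormedSpace ℝ E]
    (f : E → ℝ) (x : E) : Prop :=
  (∀ᶠ y in 𝓝 x, DifferentiableAt ℝ f y) ∧ DifferentiableAt ℝ (fderiv ℝ f) x

/-- A batch of `k` points of `ℝⁿ`, i.e. a `k × n` real matrix, given by its rows. -/
abbrev Batch (k n : ℕ) : Type := Fin k → EuclideanSpace ℝ (Fin n)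

/-- The matrix `K(X, Z)` with entries `κ (X i) (Z j)`. -/
def covMatrix {n a b : ℕ}
    (κ : EuclideanSpace ℝ (Fin n) → EuclideanSpace ℝ (Fin n) → ℝ)
    (X : Batch a n) (Z : Batch b n) : Matrix (Fin a) (Fin b) ℝ :=
  Matrix.of fun i j => κ (X i) (Z j)

/-- The prior of a Gaussian process on `ℝⁿ`: an arbitrary mean function, and a covariance
function (kernel), that is, a function all of whose Gram matrices are symmetric and positive
semidefinite. -/
structure GPPrior (n : ℕ) where
  /-- the prior mean function -/
  mean : EuclideanSpace ℝ (Fin n) → ℝ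
  /-- the prior covariance function -/
  kernel : EuclideanSpace ℝ (Fin n) → EuclideanSpace ℝ (Fin n) → ℝ
  posSemidef_gram : ∀ (a : ℕ) (X : Batch a n), (covMatrix kernel X X).PosSemidef

section GP

variable {n k l : ℕ} (gp : GPPrior n) (Xd : Batch l n) (yd : Fin l → ℝ)

/-- The posterior mean (noiseless Gaussian process regression)
`μ(X) = m(X) + K(X, Xd) K(Xd, Xd)⁻¹ (yd - m(Xd))`. -/
noncomputable def postMean (X : Batch k n) : Fin k → ℝ :=
  (fun i => gp.mean (X i)) +
    (covMatrix gp.kernel X Xd * (covMatrix gp.kernel Xd Xd)⁻¹) *ᵥ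
      (yd - fun j => gp.mean (Xd j))

/-- The posterior covariance (noiseless Gaussian process regression)
`Σ(X) = K(X, X) - K(X, Xd) K(Xd, Xd)⁻¹ K(Xd, X)`. -/
noncomputable def postCov (X : Batch k n) : Matrix (Fin k) (Fin k) ℝ :=
  covMatrix gp.kernel X X -
    covMatrix gp.kernel X Xd * (covMatrix gp.kernel Xd Xd)⁻¹ * covMatrix gp.kernel Xd X

/-- The second order moment matrix `Ω(X) = [Σ + μ μᵀ, μ; μᵀ, 1]` of the posterior. -/
noncomputable def momentMatrix (X : Batch k n) : Matrix (Fin k ⊕ Unit) (Fin k ⊕ Unit) ℝ :=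
  Matrix.fromBlocks
    (postCov gp Xd X + Matrix.vecMulVec (postMean gp Xd yd X) (postMean gp Xd yd X))
    (Matrix.replicateCol Unit (postMean gp Xd yd X))
    (Matrix.replicateRow Unit (postMean gp Xd yd X))
    1

end GP

/-- The best value observed so far, the minimum of the entries of `yd`. -/
noncomputable def bestValue {l : ℕ} [NeZero l] (yd : Fin l → ℝ) : ℝ :=
  Finset.univ.inf' Finset.univ_nonempty yd

/-- The constraint matrices: `C 0 = 0`, and `C i = [0, eᵢ/2; eᵢᵀ/2, -y]` for `i = 1, …, k`. -/
noncomputable def constraintMatrix (k : ℕ) (y : ℝ) :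
    Fin (k + 1) → Matrix (Fin k ⊕ Unit) (Fin k ⊕ Unit) ℝ :=
  Fin.cons 0 fun i =>
    Matrix.fromBlocks 0
      (Matrix.replicateCol Unit ((1 / 2 : ℝ) • Pi.single i (1 : ℝ)))
      (Matrix.replicateRow Unit ((1 / 2 : ℝ) • Pi.single i (1 : ℝ)))
      (Matrix.of fun _ _ => -y)

/-- The objective values `⟨Ω, M⟩ = tr (Ωᵀ M)` of the semidefinite program, over all symmetric
matrices `M` with `M - C i ⪯ 0` for `i = 0, …, k`. -/
def sdpValues {k : ℕ} (y : ℝ) (Ω : Matrix (Fin k ⊕ Unit) (Fin k ⊕ Unit) ℝ) : Set ℝ :=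
  {v | ∃ M : Matrix (Fin k ⊕ Unit) (Fin k ⊕ Unit) ℝ, M.IsSymm ∧
    (∀ i, (constraintMatrix k y i - M).PosSemidef) ∧ v = (Ωᵀ * M).trace}

/-- The optimal value `p(Ω)` of the semidefinite program. -/
noncomputable def sdpValue {k : ℕ} (y : ℝ) (Ω : Matrix (Fin k ⊕ Unit) (Fin k ⊕ Unit) ℝ) : ℝ :=
  sSup (sdpValues y Ω)

/-- The optimistic expected improvement acquisition function `X ↦ p(Ω(X))`. -/
noncomputable def oei {n k l : ℕ} [NeZero l] (gp : GPPrior n) (Xd : Batch l n) (yd : Fin l → ℝ)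
    (X : Batch k n) : ℝ :=
  sdpValue (bestValue yd) (momentMatrix gp Xd yd X)

end OEI

/-! Since `Σ(X)` is positive definite, so is `Ω(X)`; the core is that the optimal value `p` is twice
continuously differentiable near a positive definite `Ω`, as far as symmetric arguments are
concerned. The chain rule then finishes.

The program has as many constraints as `Ω` has rows. At an optimum `M` each slack `C i - M` has
kernel of dimension at most one, and first-order optimality gives strict complementarity: `Ω = V
Vᵀ`, where column `vᵢ` of `V` spans the kernel of `C i - M` (`exists_factorization`). Hence `vᵢᵀ C j
vⱼ = vᵢᵀ M vⱼ` is symmetric in `i, j`.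

Conversely, `V Vᵀ = Ω` together with this symmetry is a square polynomial system for `V`, with `M`
eliminated: the first condition occupies the symmetric part, the second the antisymmetric part of
`stationarityMap`. Its derivative at `V` is injective (`stationarityDeriv_injective`), so the
inverse function theorem gives a smooth solution `V(Ω')`. The remaining optimality conditions are
open, so for symmetric `Ω'` near `Ω` this solution certifies `p(Ω') = ∑ᵢ vᵢᵀ C i vᵢ`
(`isGreatest_trace_crossGram`). -/

namespace OEI

/-! ### Quadratic forms and positive semidefinite matrices -/

section Abstract

variable {ι : Type*} [Fintype ι]

theorem posSemidef_real_iff {A : Matrix ι ι ℝ} :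
    A.PosSemidef ↔ A.IsSymm ∧ ∀ z : ι → ℝ, 0 ≤ z ⬝ᵥ A *ᵥ z := by
  rw [Matrix.posSemidef_iff_dotProduct_mulVec]
  simp [Matrix.IsHermitian, Matrix.IsSymm, Matrix.conjTranspose_eq_transpose_of_trivial]

theorem dotProduct_mulVec_smul_self (A : Matrix ι ι ℝ) (c : ℝ) (z : ι → ℝ) :
    (c • z) ⬝ᵥ A *ᵥ (c • z) = c ^ 2 * (z ⬝ᵥ A *ᵥ z) := by
  simp [Matrix.mulVec_smul]; ring

theorem exists_sphere_smul {z : ι → ℝ} (hz : z ≠ 0) :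
    ∃ u ∈ Metric.sphere (0 : ι → ℝ) 1, z = ‖z‖ • u := by
  have h : ‖z‖ ≠ 0 := norm_ne_zero_iff.2 hz
  refine ⟨‖z‖⁻¹ • z, by simp [norm_smul, h], ?_⟩
  rw [smul_smul, mul_inv_cancel₀ h, one_smul]

/-- If a symmetric matrix `H` is negative on the kernel of a positive semidefinite matrix `S`,
then `S - ε H` is positive semidefinite for small positive `ε`. -/
theorem eventually_posSemidef_sub_smul {S H : Matrix ι ι ℝ} (hS : S.PosSemidef) (hH : H.IsSymm)
    (hneg : ∀ z, z ≠ 0 → S *ᵥ z = 0 → z ⬝ᵥ H *ᵥ z < 0) :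
    ∀ᶠ ε in 𝓝[>] (0 : ℝ), (S - ε • H).PosSemidef := by
  -- By homogeneity and compactness it suffices to work near each unit vector `u`. If `uᵀSu > 0`,
  -- continuity is enough; otherwise `uᵀHu < 0` persists nearby and the `S` term only helps.
  have key : ∀ᶠ ε in 𝓝 (0 : ℝ), ∀ u ∈ Metric.sphere (0 : ι → ℝ) 1,
      0 < ε → 0 < u ⬝ᵥ (S - ε • H) *ᵥ u := by
    refine (isCompact_sphere (0 : ι → ℝ) 1).eventually_forall_of_forall_eventually fun u hu => ?_
    have hu0 : u ≠ 0 := by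
      rintro rfl
      simp at hu
    rcases ((posSemidef_real_iff.1 hS).2 u).lt_or_eq with hpos | hzero
    · have hc : Continuous fun p : ℝ × (ι → ℝ) => p.2 ⬝ᵥ (S - p.1 • H) *ᵥ p.2 := by fun_prop
      have : ∀ᶠ p in 𝓝 ((0 : ℝ), u), 0 < p.2 ⬝ᵥ (S - p.1 • H) *ᵥ p.2 :=
        hc.continuousAt.eventually_const_lt (by simpa using hpos)
      exact this.mono fun p hp _ => hp
    · have hker : S *ᵥ u = 0 := (hS.dotProduct_mulVec_zero_iff u).1 (by simpa using hzero.symm)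
      have hc : Continuous fun p : ℝ × (ι → ℝ) => p.2 ⬝ᵥ H *ᵥ p.2 := by fun_prop
      have : ∀ᶠ p in 𝓝 ((0 : ℝ), u), p.2 ⬝ᵥ H *ᵥ p.2 < 0 :=
        hc.continuousAt.eventually_lt_const (hneg u hu0 hker)
      refine this.mono fun p hp hε => ?_
      have h1 := (posSemidef_real_iff.1 hS).2 p.2
      rw [Matrix.sub_mulVec, Matrix.smul_mulVec, dotProduct_sub, dotProduct_smul, smul_eq_mul]
      nlinarith
  filter_upwards [key.filter_mono nhdsWithin_le_nhds, self_mem_nhdsWithin] with ε h hε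
  have hSs := (posSemidef_real_iff.1 hS).1
  refine posSemidef_real_iff.2 ⟨hSs.sub (hH.smul ε), fun z => ?_⟩
  by_cases hz : z = 0
  · simp [hz]
  · obtain ⟨u, hu, hzu⟩ := exists_sphere_smul hz
    rw [hzu, dotProduct_mulVec_smul_self]
    exact mul_nonneg (sq_nonneg _) (h u hu hε).le

-- Write `A = LᴴL`; by cyclicity the trace is that of the positive semidefinite matrix `L B Lᴴ`.
open scoped MatrixOrder Matrix.Norms.L2Operator in
theorem trace_mul_nonneg {A B : Matrix ι ι ℝ} (hA : A.PosSemidef) (hB : B.PosSemidef) :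
    0 ≤ (A * B).trace := by
  classical
  obtain ⟨L, rfl⟩ := CStarAlgebra.nonneg_iff_eq_star_mul_self.1 hA.nonneg
  rw [Matrix.star_eq_conjTranspose, Matrix.mul_assoc, Matrix.trace_mul_comm]
  exact (hB.mul_mul_conjTranspose_same L).trace_nonneg

/-- Testing on `eᵢ ± eⱼ` gives `2|A i j| ≤ A i i + A j j`. Used to turn a trace bound into
compactness. -/
theorem abs_apply_le_trace {A : Matrix ι ι ℝ} (hA : A.PosSemidef) (i j : ι) :
    |A i j| ≤ A.trace := by
  classical
  have hdiag : ∀ i, A i i ≤ A.trace := fun i =>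
    Finset.single_le_sum (f := fun i => A i i) (fun i _ => hA.diag_nonneg) (Finset.mem_univ i)
  have hs : A j i = A i j := (posSemidef_real_iff.1 hA).1.apply i j
  have hp := (posSemidef_real_iff.1 hA).2 (Pi.single i 1 + Pi.single j 1)
  have hm := (posSemidef_real_iff.1 hA).2 (Pi.single i 1 - Pi.single j 1)
  simp [Matrix.mulVec_add, Matrix.mulVec_sub, add_dotProduct, sub_dotProduct] at hp hm
  have := hdiag i
  have := hdiag j
  rw [abs_le]
  constructor <;> linarith

theorem trace_vecMulVec_mul (u v : ι → ℝ) (A : Matrix ι ι ℝ) :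
    (A * Matrix.vecMulVec u v).trace = v ⬝ᵥ A *ᵥ u := by
  rw [Matrix.mul_vecMulVec, Matrix.trace_vecMulVec, dotProduct_comm]

/-! ### The semidefinite program: existence of optima and strict complementarity -/

/-- `M` is feasible for the semidefinite program with constraints `M ⪯ C i`. -/
def Feasible (C : ι → Matrix ι ι ℝ) (M : Matrix ι ι ℝ) : Prop :=
  M.IsSymm ∧ ∀ i, (C i - M).PosSemidef

/-- A family of constraint matrices that vanish as quadratic forms on the hyperplane `z t = 0`
and that jointly separate its points. -/
structure NondegenerateFamily (C : ι → Matrix ι ι ℝ) (t : ι) : Prop where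
  isSymm : ∀ i, (C i).IsSymm
  isotropic : ∀ i z, z t = 0 → z ⬝ᵥ C i *ᵥ z = 0
  separating : ∀ z, z t = 0 → (∀ i j, C i *ᵥ z = C j *ᵥ z) → z = 0
  exists_feasible : ∃ M, Feasible C M

variable {C : ι → Matrix ι ι ℝ} {t : ι} {M Ω : Matrix ι ι ℝ}

/-- On the hyperplane all forms `C j` vanish, so a kernel vector of one slack is isotropic for `M`,
hence for every slack, hence lies in all their kernels. Then all `C j z` equal `M z`, and separation
applies. -/
theorem NondegenerateFamily.eq_zero_of_mem_ker (hC : NondegenerateFamily C t) (hM : Feasible C M)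
    {i : ι} {z : ι → ℝ} (hzt : z t = 0) (hz : (C i - M) *ᵥ z = 0) : z = 0 := by
  have hMz : z ⬝ᵥ M *ᵥ z = 0 := by
    have h := congrArg (fun w => z ⬝ᵥ w) hz
    simp only [Matrix.sub_mulVec, dotProduct_sub, dotProduct_zero, hC.isotropic i z hzt] at h
    linarith
  have hker : ∀ j, C j *ᵥ z = M *ᵥ z := fun j => by
    have h : (C j - M) *ᵥ z = 0 := ((hM.2 j).dotProduct_mulVec_zero_iff z).1 (by
      simp [Matrix.sub_mulVec, hC.isotropic j z hzt, hMz])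
    rwa [Matrix.sub_mulVec, sub_eq_zero] at h
  exact hC.separating z hzt fun i j => (hker i).trans (hker j).symm

theorem NondegenerateFamily.neg_of_apply_eq_zero (hC : NondegenerateFamily C t)
    (hM : Feasible C M) {z : ι → ℝ} (hzt : z t = 0) (hz : z ≠ 0) : z ⬝ᵥ M *ᵥ z < 0 := by
  have heq : z ⬝ᵥ (C t - M) *ᵥ z = -(z ⬝ᵥ M *ᵥ z) := by
    simp [Matrix.sub_mulVec, hC.isotropic t z hzt]
  have h := (posSemidef_real_iff.1 (hM.2 t)).2 z
  rcases h.lt_or_eq with h | h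
  · linarith
  · exact absurd (hC.eq_zero_of_mem_ker hM hzt
      (((hM.2 t).dotProduct_mulVec_zero_iff z).1 (by simpa using h.symm))) hz

/-- The kernel meets the hyperplane `z t = 0` only in `0`, so it is at most a line. A trivial kernel
is covered by `v = 0`; optimality rules this out later. -/
theorem NondegenerateFamily.exists_ker_span (hC : NondegenerateFamily C t) (hM : Feasible C M)
    (i : ι) : ∃ v, (C i - M) *ᵥ v = 0 ∧ ∀ w, (C i - M) *ᵥ w = 0 → ∃ c : ℝ, w = c • v := by
  by_cases h : ∃ v, v ≠ 0 ∧ (C i - M) *ᵥ v = 0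
  · obtain ⟨v, hv0, hv⟩ := h
    refine ⟨v, hv, fun w hw => ?_⟩
    have hvt : v t ≠ 0 := fun h0 => hv0 (hC.eq_zero_of_mem_ker hM h0 hv)
    refine ⟨w t / v t, sub_eq_zero.1 (hC.eq_zero_of_mem_ker hM (i := i) ?_ ?_)⟩
    · simp [hvt]
    · rw [Matrix.mulVec_sub, Matrix.mulVec_smul, hv, hw]; simp
  · push Not at h
    exact ⟨0, by simp, fun w hw => ⟨0, by
      by_contra hne
      exact h w (by simpa using hne) hw⟩⟩

theorem isClosed_setOf_feasible (C : ι → Matrix ι ι ℝ) : IsClosed {M | Feasible C M} := by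
  simp only [Feasible, posSemidef_real_iff, Matrix.IsSymm, Set.ofPred_and, Set.ofPred_forall]
  refine (isClosed_eq (by fun_prop) (by fun_prop)).inter (isClosed_iInter fun i =>
    (isClosed_eq (by fun_prop) (by fun_prop)).inter (isClosed_iInter fun z =>
      isClosed_le (by fun_prop) (by fun_prop)))

theorem NondegenerateFamily.exists_optimal (hC : NondegenerateFamily C t) (hΩ : Ω.PosDef) :
    ∃ M, Feasible C M ∧ ∀ M', Feasible C M' → (Ω * M').trace ≤ (Ω * M).trace := by
  classical
  obtain ⟨M₀, hM₀⟩ := hC.exists_feasible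
  -- `Ω - ε I` is still positive semidefinite: the kernel condition is vacuous because `Ω` is
  -- invertible.
  obtain ⟨ε, hε, hε0⟩ := ((eventually_posSemidef_sub_smul hΩ.posSemidef (H := 1)
    Matrix.isSymm_one (fun z hz h0 => absurd
      (Matrix.eq_zero_of_mulVec_eq_zero (Matrix.isUnit_iff_isUnit_det _ |>.1 hΩ.isUnit).ne_zero h0)
      hz)).and self_mem_nhdsWithin).exists
  replace hε0 : 0 < ε := hε0
  -- For feasible `M` at least as good as `M₀`, `tr ((Ω - ε I)(C t - M)) ≥ 0` yields `tr (C t - M) ≤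
  -- r`, so the superlevel set is bounded.
  set r : ℝ := ((Ω * C t).trace - (Ω * M₀).trace) / ε
  let K : Set (Matrix ι ι ℝ) :=
    {M | ∀ i, M i ∈ {w : ι → ℝ | ∀ j, w j ∈ Set.Icc (C t i j - r) (C t i j + r)}}
  have hK : IsCompact K := isCompact_pi_infinite fun i => isCompact_pi_infinite fun j =>
    isCompact_Icc
  let T : Set (Matrix ι ι ℝ) := {M | Feasible C M} ∩ {M | (Ω * M₀).trace ≤ (Ω * M).trace}
  have hTK : T ⊆ K := by
    rintro M ⟨hM, hle⟩ i j
    have h1 := trace_mul_nonneg hε (hM.2 t)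
    rw [Matrix.sub_mul, Matrix.trace_sub, Matrix.smul_mul, Matrix.one_mul, Matrix.trace_smul,
      Matrix.mul_sub, Matrix.trace_sub, smul_eq_mul] at h1
    have h2 : (C t - M).trace ≤ r := by
      rw [le_div_iff₀ hε0]
      have : (Ω * M₀).trace ≤ (Ω * M).trace := hle
      linarith
    have h3 := abs_le.1 ((abs_apply_le_trace (hM.2 t) i j).trans h2)
    rw [Matrix.sub_apply] at h3
    exact ⟨by linarith [h3.2], by linarith [h3.1]⟩
  have hTc : IsCompact T := hK.of_isClosed_subset
    ((isClosed_setOf_feasible C).inter (isClosed_le (by fun_prop) (by fun_prop))) hTK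
  obtain ⟨M, hMT, hmax⟩ := hTc.exists_isMaxOn ⟨M₀, hM₀, le_refl (Ω * M₀).trace⟩
    (f := fun M => (Ω * M).trace) (by fun_prop)
  refine ⟨M, hMT.1, fun M' hM' => ?_⟩
  by_cases h : (Ω * M₀).trace ≤ (Ω * M').trace
  · exact hmax ⟨hM', h⟩
  · exact (not_le.1 h).le.trans hMT.2

/-- First order optimality: a direction that is nonpositive on all the kernels of the slack
matrices does not increase the objective. -/
theorem trace_mul_nonpos_of_optimal (hM : Feasible C M)
    (hopt : ∀ M', Feasible C M' → (Ω * M').trace ≤ (Ω * M).trace) {v : ι → ι → ℝ}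
    (hspan : ∀ i w, (C i - M) *ᵥ w = 0 → ∃ c : ℝ, w = c • v i) {H : Matrix ι ι ℝ}
    (hH : H.IsSymm) (hHv : ∀ i, v i ⬝ᵥ H *ᵥ v i ≤ 0) : (Ω * H).trace ≤ 0 := by
  classical
  by_contra! hpos
  -- Tilting `H` by `-δ I` makes it strictly negative on the kernels while it still improves the
  -- objective, so a small step along it stays feasible.
  obtain ⟨δ, hδ, hδ0⟩ : ∃ δ : ℝ, 0 < (Ω * (H - δ • 1)).trace ∧ 0 < δ := by
    have hc : Continuous fun δ : ℝ => (Ω * (H - δ • 1)).trace := by fun_prop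
    have : ∀ᶠ δ in 𝓝 (0 : ℝ), 0 < (Ω * (H - δ • 1)).trace :=
      hc.continuousAt.eventually_const_lt (by simpa using hpos)
    exact ((this.filter_mono nhdsWithin_le_nhds).and self_mem_nhdsWithin).exists (f := 𝓝[>] 0)
  have hH' : (H - δ • (1 : Matrix ι ι ℝ)).IsSymm := hH.sub (Matrix.isSymm_one.smul δ)
  have hev : ∀ᶠ ε in 𝓝[>] (0 : ℝ), ∀ i, (C i - M - ε • (H - δ • 1)).PosSemidef := by
    refine Filter.eventually_all.2 fun i => eventually_posSemidef_sub_smul (hM.2 i) hH' ?_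
    intro z hz hker
    obtain ⟨c, rfl⟩ := hspan i z hker
    have h1 : 0 < (c • v i) ⬝ᵥ (c • v i) := by
      simpa using Matrix.dotProduct_star_self_pos_iff.2 hz
    have h2 : (c • v i) ⬝ᵥ H *ᵥ (c • v i) ≤ 0 := by
      rw [dotProduct_mulVec_smul_self]
      exact mul_nonpos_of_nonneg_of_nonpos (sq_nonneg c) (hHv i)
    rw [Matrix.sub_mulVec, dotProduct_sub, Matrix.smul_mulVec, Matrix.one_mulVec, dotProduct_smul,
      smul_eq_mul]
    nlinarith
  obtain ⟨ε, hε, hε0⟩ := (hev.and self_mem_nhdsWithin).exists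
  replace hε0 : 0 < ε := hε0
  have := hopt (M + ε • (H - δ • 1)) ⟨hM.1.add (hH'.smul ε), fun i => by
    rw [← sub_sub]; exact hε i⟩
  rw [Matrix.mul_add, Matrix.trace_add, Matrix.mul_smul, Matrix.trace_smul, smul_eq_mul] at this
  nlinarith

/-- Strict complementarity: at an optimum of the semidefinite program the slack matrices have
one-dimensional kernels, and suitably scaled kernel vectors give a factorization of `Ω`. -/
theorem NondegenerateFamily.exists_factorization [DecidableEq ι] (hC : NondegenerateFamily C t)
    (hΩ : Ω.PosDef) : ∃ M V : Matrix ι ι ℝ, Feasible C M ∧ V * Vᵀ = Ω ∧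
      (∀ i, (C i - M) *ᵥ Vᵀ i = 0) ∧
      ∀ i w, (C i - M) *ᵥ w = 0 → ∃ c : ℝ, w = c • Vᵀ i := by
  obtain ⟨M, hM, hopt⟩ := hC.exists_optimal hΩ
  choose v hker hspan using hC.exists_ker_span hM
  have hdir := fun {H : Matrix ι ι ℝ} => trace_mul_nonpos_of_optimal hM hopt hspan (H := H)
  let V₀ : Matrix ι ι ℝ := (Matrix.of v)ᵀ
  -- If `w` were orthogonal to every `vᵢ`, the direction `w wᵀ` would force `wᵀΩw ≤ 0`.
  have hdet : V₀.det ≠ 0 := by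
    intro h0
    obtain ⟨w, hw0, hw⟩ := Matrix.exists_vecMul_eq_zero_iff.2 h0
    have hwv : ∀ i, w ⬝ᵥ v i = 0 := fun i => congrFun hw i
    have h1 := hdir (H := Matrix.vecMulVec w w) (by
      simp [Matrix.IsSymm, Matrix.transpose_vecMulVec]) (fun i => by
        simp [Matrix.vecMulVec_mulVec, hwv i])
    rw [trace_vecMulVec_mul] at h1
    have h2 := hΩ.dotProduct_mulVec_pos hw0
    rw [star_trivial] at h2
    linarith
  have hunit : IsUnit V₀.det := isUnit_iff_ne_zero.2 hdet
  -- The rows of `U` form the basis dual to the `vᵢ`. It remains to see that `U Ω Uᵀ` is diagonal;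
  -- its diagonal entries then rescale the `vᵢ`.
  set U := V₀⁻¹
  have hUV : ∀ i l, U i ⬝ᵥ v l = if i = l then 1 else 0 := fun i l => by
    have := congrFun (congrFun (Matrix.nonsing_inv_mul V₀ hunit) i) l
    rwa [Matrix.one_apply] at this
  have hNapp : ∀ i j, (U * Ω * Uᵀ) i j = U i ⬝ᵥ Ω *ᵥ U j := fun i j => by
    rw [Matrix.dotProduct_mulVec]; rfl
  have hN : (U * Ω * Uᵀ).PosDef := by
    rw [← Matrix.conjTranspose_eq_transpose_of_trivial]
    refine hΩ.mul_mul_conjTranspose_same (Matrix.vecMul_injective_of_isUnit ?_)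
    exact (Matrix.isUnit_nonsing_inv_iff.2 ((Matrix.isUnit_iff_isUnit_det _).2 hunit))
  -- For `i ≠ j`, both signs of `uᵢuⱼᵀ + uⱼuᵢᵀ` vanish on every `v l`, so both are admissible
  -- directions.
  have hoff : ∀ i j, i ≠ j → (U * Ω * Uᵀ) i j = 0 := by
    intro i j hij
    have hs : (U * Ω * Uᵀ) j i = (U * Ω * Uᵀ) i j :=
      (posSemidef_real_iff.1 hN.posSemidef).1.apply i j
    have hb : ∀ s : ℝ, s * (U * Ω * Uᵀ) i j ≤ 0 := fun s => by
      have h1 := hdir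
        (H := s • (Matrix.vecMulVec (U i) (U j) + Matrix.vecMulVec (U j) (U i))) (by
          simp [Matrix.IsSymm, Matrix.transpose_vecMulVec, add_comm]) (fun l => by
            have : (U i ⬝ᵥ v l) * (U j ⬝ᵥ v l) = 0 := by
              rw [hUV, hUV]; split_ifs <;> simp_all
            simp [Matrix.smul_mulVec, Matrix.add_mulVec, Matrix.vecMulVec_mulVec,
              dotProduct_comm (v l)]
            rw [mul_comm (U j ⬝ᵥ v l), this]
            simp)
      rw [Matrix.mul_smul, Matrix.trace_smul, Matrix.mul_add, Matrix.trace_add,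
        trace_vecMulVec_mul, trace_vecMulVec_mul, ← hNapp, ← hNapp, hs, smul_eq_mul] at h1
      linarith
    have h1 := hb 1
    have h2 := hb (-1)
    linarith
  let d : ι → ℝ := fun i => (U * Ω * Uᵀ) i i
  have hd : ∀ i, 0 < d i := fun i => hN.diag_pos
  have hNd : U * Ω * Uᵀ = Matrix.diagonal d := by
    ext i j
    by_cases hij : i = j
    · subst hij; simp [d]
    · rw [hoff i j hij, Matrix.diagonal_apply_ne _ hij]
  let V : Matrix ι ι ℝ := V₀ * Matrix.diagonal fun i => √(d i)
  have hV : ∀ i, Vᵀ i = √(d i) • v i := fun i => by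
    ext j
    simp [V, V₀, mul_comm]
  refine ⟨M, V, hM, ?_, fun i => ?_, fun i w hw => ?_⟩
  · have h1 : V * Vᵀ = V₀ * Matrix.diagonal d * V₀ᵀ := by
      simp only [V, Matrix.transpose_mul, Matrix.diagonal_transpose]
      rw [Matrix.mul_assoc, ← Matrix.mul_assoc (Matrix.diagonal _), Matrix.diagonal_mul_diagonal,
        ← Matrix.mul_assoc]
      congr 3
      ext i
      exact Real.mul_self_sqrt (hd i).le
    have hVU : V₀ * U = 1 := Matrix.mul_nonsing_inv V₀ hunit
    have hUVt : Uᵀ * V₀ᵀ = 1 := by rw [← Matrix.transpose_mul, hVU, Matrix.transpose_one]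
    rw [h1, ← hNd]
    calc V₀ * (U * Ω * Uᵀ) * V₀ᵀ = (V₀ * U) * Ω * (Uᵀ * V₀ᵀ) := by noncomm_ring
      _ = Ω := by rw [hVU, hUVt, Matrix.one_mul, Matrix.mul_one]
  · rw [hV, Matrix.mulVec_smul, hker, smul_zero]
  · obtain ⟨c, hc⟩ := hspan i w hw
    refine ⟨c / √(d i), ?_⟩
    rw [hV, smul_smul, div_mul_cancel₀ _ (Real.sqrt_pos.2 (hd i)).ne', hc]

/-! ### Stationary factorizations and their linearization -/

variable {V : Matrix ι ι ℝ}

/-- The matrix of the numbers `vᵢ ⬝ C j wⱼ`, for the columns `vᵢ` of `V` and `wⱼ` of `W`. -/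
def crossGram (C : ι → Matrix ι ι ℝ) (V W : Matrix ι ι ℝ) : Matrix ι ι ℝ :=
  Matrix.of fun i j => Vᵀ i ⬝ᵥ C j *ᵥ Wᵀ j

theorem crossGram_add_left (C : ι → Matrix ι ι ℝ) (U V W : Matrix ι ι ℝ) :
    crossGram C (U + V) W = crossGram C U W + crossGram C V W := by
  ext i j
  exact add_dotProduct (Uᵀ i) (Vᵀ i) (C j *ᵥ Wᵀ j)

theorem crossGram_add_right (C : ι → Matrix ι ι ℝ) (U V W : Matrix ι ι ℝ) :
    crossGram C U (V + W) = crossGram C U V + crossGram C U W := by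
  ext i j
  change Uᵀ i ⬝ᵥ C j *ᵥ (Vᵀ j + Wᵀ j) = _
  rw [Matrix.mulVec_add, dotProduct_add]
  rfl

theorem crossGram_smul_left (C : ι → Matrix ι ι ℝ) (c : ℝ) (V W : Matrix ι ι ℝ) :
    crossGram C (c • V) W = c • crossGram C V W := by
  ext i j
  exact smul_dotProduct c (Vᵀ i) (C j *ᵥ Wᵀ j)

theorem crossGram_smul_right (C : ι → Matrix ι ι ℝ) (c : ℝ) (V W : Matrix ι ι ℝ) :
    crossGram C V (c • W) = c • crossGram C V W := by
  ext i j
  change Vᵀ i ⬝ᵥ C j *ᵥ (c • Wᵀ j) = _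
  rw [Matrix.mulVec_smul, dotProduct_smul]
  rfl

theorem dotProduct_mulVec_mulVec (A V : Matrix ι ι ℝ) (a : ι → ℝ) :
    (V *ᵥ a) ⬝ᵥ A *ᵥ (V *ᵥ a) = a ⬝ᵥ (Vᵀ * A * V) *ᵥ a := by
  rw [← Matrix.mulVec_mulVec, ← Matrix.mulVec_mulVec, Matrix.dotProduct_mulVec a,
    Matrix.vecMul_transpose]

/-- The polynomial map whose value is a symmetric matrix `Ω` exactly at the stationary
factorizations `V Vᵀ = Ω`. -/
def stationarityMap (C : ι → Matrix ι ι ℝ) (V : Matrix ι ι ℝ) : Matrix ι ι ℝ :=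
  V * Vᵀ + (crossGram C V V - (crossGram C V V)ᵀ)

/-- The derivative of `stationarityMap` at `V`. -/
def stationarityDeriv (C : ι → Matrix ι ι ℝ) (V : Matrix ι ι ℝ) :
    Matrix ι ι ℝ →ₗ[ℝ] Matrix ι ι ℝ where
  toFun D := D * Vᵀ + V * Dᵀ +
    ((crossGram C D V + crossGram C V D) - (crossGram C D V + crossGram C V D)ᵀ)
  map_add' D E := by
    ext i j
    simp [crossGram_add_left, crossGram_add_right, Matrix.add_mul, Matrix.mul_add]
    ring
  map_smul' c D := by
    ext i j
    simp [crossGram_smul_left, crossGram_smul_right]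
    ring

theorem stationarityMap_add_smul (C : ι → Matrix ι ι ℝ) (V D : Matrix ι ι ℝ) (s : ℝ) :
    stationarityMap C (V + s • D) =
      stationarityMap C V + s • stationarityDeriv C V D + s ^ 2 • stationarityMap C D := by
  ext i j
  simp [stationarityMap, stationarityDeriv, crossGram_add_left, crossGram_add_right,
    crossGram_smul_left, crossGram_smul_right, Matrix.add_mul, Matrix.mul_add]
  ring

theorem eq_and_isSymm_of_stationarityMap_eq (hΩ : Ω.IsSymm) (h : stationarityMap C V = Ω) :
    V * Vᵀ = Ω ∧ (crossGram C V V).IsSymm := by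
  have hij := fun i j => congrFun (congrFun h i) j
  have hVs : (V * Vᵀ).IsSymm := by simp [Matrix.IsSymm]
  have hB : ∀ i j, crossGram C V V i j = crossGram C V V j i := fun i j => by
    have h1 := hij i j
    have h2 := hij j i
    simp only [stationarityMap, Matrix.add_apply, Matrix.sub_apply, Matrix.transpose_apply,
      hVs.apply i j, hΩ.apply i j] at h1 h2
    linarith
  refine ⟨?_, Matrix.IsSymm.ext fun i j => hB j i⟩
  ext i j
  rw [← hij i j, stationarityMap, Matrix.add_apply, Matrix.sub_apply, Matrix.transpose_apply,
    hB i j, sub_self, add_zero]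

theorem crossGram_eq_of_ker (h : ∀ i, (C i - M) *ᵥ Vᵀ i = 0) (W : Matrix ι ι ℝ) :
    crossGram C W V = Wᵀ * M * V := by
  have h' : ∀ i, C i *ᵥ Vᵀ i = M *ᵥ Vᵀ i := fun i => by
    simpa [Matrix.sub_mulVec, sub_eq_zero] using h i
  ext i j
  rw [crossGram, Matrix.of_apply, h', Matrix.mul_assoc]
  rfl

/-- A kernel element is `D = V G` with `G` antisymmetric, while `E i j = vᵢᵀ(C j - M)dⱼ` is
symmetric. So `∑ⱼ dⱼᵀ(C j - M)dⱼ = ∑ G i j * E i j = 0`; by semidefiniteness each `dⱼ` lies in the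
kernel spanned by `vⱼ`. Thus `G` is diagonal as well as antisymmetric, hence zero. -/
theorem stationarityDeriv_injective [DecidableEq ι] (hM : Feasible C M) (hV : IsUnit V.det)
    (hker : ∀ i, (C i - M) *ᵥ Vᵀ i = 0)
    (hspan : ∀ i w, (C i - M) *ᵥ w = 0 → ∃ c : ℝ, w = c • Vᵀ i) :
    Function.Injective (stationarityDeriv C V) := by
  rw [injective_iff_map_eq_zero]
  intro D hD
  set B := crossGram C D V + crossGram C V D with hB
  have hL : ∀ i j, (D * Vᵀ + V * Dᵀ) i j + (B i j - B j i) = 0 := fun i j =>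
    congrFun (congrFun hD i) j
  have hXs : (D * Vᵀ + V * Dᵀ).IsSymm := by simp [Matrix.IsSymm, add_comm]
  have hBs : ∀ i j, B i j = B j i := fun i j => by
    have h1 := hL i j
    have h2 := hL j i
    rw [hXs.apply i j] at h2
    linarith
  have hX : D * Vᵀ + V * Dᵀ = 0 := by
    ext i j
    have := hL i j
    rw [hBs i j] at this
    simpa using this
  set G := V⁻¹ * D with hG
  have hDG : D = V * G := by rw [hG, Matrix.mul_nonsing_inv_cancel_left _ _ hV]
  clear_value G
  have hanti : G + Gᵀ = 0 := by
    have h1 : V * (G + Gᵀ) * Vᵀ = 0 := by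
      have h2 : V * G * Vᵀ + V * (V * G)ᵀ = 0 := by rw [← hDG, hX]
      rw [← h2, Matrix.transpose_mul]; noncomm_ring
    have hVt : IsUnit Vᵀ.det := by rwa [Matrix.det_transpose]
    have h2 := congrArg (fun A => V⁻¹ * (A * Vᵀ⁻¹)) h1
    simpa [Matrix.mul_nonsing_inv_cancel_right _ _ hVt,
      Matrix.nonsing_inv_mul_cancel_left _ _ hV] using h2
  have hGa : ∀ i j, G j i = -G i j := fun i j => by
    have := congrFun (congrFun hanti i) j
    simp only [Matrix.add_apply, Matrix.transpose_apply, Matrix.zero_apply] at this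
    linarith
  let E : Matrix ι ι ℝ := Matrix.of fun i j => Vᵀ i ⬝ᵥ (C j - M) *ᵥ Dᵀ j
  have hE : B = Dᵀ * M * V + Vᵀ * M * D + E := by
    rw [hB, crossGram_eq_of_ker hker, add_assoc]
    congr 1
    ext i j
    have : (Vᵀ * M * D) i j = Vᵀ i ⬝ᵥ M *ᵥ Dᵀ j := by rw [Matrix.mul_assoc]; rfl
    simp [crossGram, E, this, Matrix.sub_mulVec]
  have hEs : ∀ i j, E i j = E j i := fun i j => by
    have hs : (Dᵀ * M * V + Vᵀ * M * D).IsSymm := by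
      simp [Matrix.IsSymm, hM.1.eq, Matrix.mul_assoc, add_comm]
    have h1 := hBs i j
    have h2 := hs.apply i j
    rw [hE] at h1
    simp only [Matrix.add_apply] at h1 h2
    linarith
  have hcol : ∀ j, Dᵀ j = ∑ i, G i j • Vᵀ i := fun j => by
    ext r
    simp [hDG, Matrix.mul_apply, mul_comm]
  have hq : ∀ j, Dᵀ j ⬝ᵥ (C j - M) *ᵥ Dᵀ j = ∑ i, G i j * E i j := fun j => by
    nth_rewrite 1 [hcol j]
    simp [sum_dotProduct, E]
  have hsum : ∑ j, Dᵀ j ⬝ᵥ (C j - M) *ᵥ Dᵀ j = 0 := by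
    have h1 : ∑ j, ∑ i, G i j * E i j = -∑ j, ∑ i, G i j * E i j := by
      conv_lhs => rw [Finset.sum_comm]
      rw [← Finset.sum_neg_distrib]
      refine Finset.sum_congr rfl fun i _ => ?_
      rw [← Finset.sum_neg_distrib]
      refine Finset.sum_congr rfl fun j _ => ?_
      rw [hGa j i, hEs i j, neg_mul]
    simp only [hq]
    linarith
  have hzero := (Finset.sum_eq_zero_iff_of_nonneg fun j _ =>
    (posSemidef_real_iff.1 (hM.2 j)).2 (Dᵀ j)).1 hsum
  have hDker : ∀ j, (C j - M) *ᵥ Dᵀ j = 0 := fun j =>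
    ((hM.2 j).dotProduct_mulVec_zero_iff _).1 (by simpa using hzero j (Finset.mem_univ j))
  choose c hc using fun j => hspan j _ (hDker j)
  have hGd : G = Matrix.diagonal c := by
    rw [hG, show D = V * Matrix.diagonal c from ?_, Matrix.nonsing_inv_mul_cancel_left _ _ hV]
    ext i j
    have := congrFun (hc j) i
    simpa [mul_comm] using this
  have hc0 : c = 0 := by
    ext i
    have := hGa i i
    simp only [hGd, Matrix.diagonal_apply_eq] at this
    simp only [Pi.zero_apply]
    linarith
  rw [hDG, hGd, hc0]
  simp

/-! ### Optimality certificate -/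

/-- The objective values `tr (Ωᵀ M)` over the feasible matrices `M`. -/
def feasibleValues (C : ι → Matrix ι ι ℝ) (Ω : Matrix ι ι ℝ) : Set ℝ :=
  {v | ∃ M, Feasible C M ∧ v = (Ωᵀ * M).trace}

/-- Sufficient optimality conditions: a stationary factorization of `Ω` certifies the value of the
semidefinite program. -/
theorem NondegenerateFamily.isGreatest_trace_crossGram [DecidableEq ι]
    (hC : NondegenerateFamily C t) (hV : IsUnit V.det) (hVΩ : V * Vᵀ = Ω) (hB : (crossGram C V V).IsSymm)
    (ht : ∀ i, V t i ≠ 0)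
    (hneg : ∀ a, a ≠ 0 → (V *ᵥ a) t = 0 → a ⬝ᵥ crossGram C V V *ᵥ a < 0) :
    IsGreatest (feasibleValues C Ω) (crossGram C V V).trace := by
  have hVt : IsUnit Vᵀ.det := by rwa [Matrix.det_transpose]
  -- The only matrix with `Vᵀ M V` equal to the cross Gram matrix.
  set M := Vᵀ⁻¹ * crossGram C V V * V⁻¹ with hM
  have hΩs : Ωᵀ = Ω := by simp [← hVΩ]
  have hMs : M.IsSymm := by
    simp [hM, Matrix.IsSymm, Matrix.transpose_nonsing_inv, hB.eq, Matrix.mul_assoc]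
  have hBM : crossGram C V V = Vᵀ * M * V := by
    rw [hM, Matrix.mul_assoc Vᵀ⁻¹, Matrix.mul_nonsing_inv_cancel_left _ _ hVt,
      Matrix.nonsing_inv_mul_cancel_right _ _ hV]
  have hker : ∀ j, (C j - M) *ᵥ Vᵀ j = 0 := fun j => by
    have h1 : Vᵀ *ᵥ ((C j - M) *ᵥ Vᵀ j) = 0 := by
      ext i
      have h2 := congrFun (congrFun hBM i) j
      rw [Matrix.mul_assoc] at h2
      have h3 : (Vᵀ * (M * V)) i j = Vᵀ i ⬝ᵥ M *ᵥ Vᵀ j := rfl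
      rw [h3, crossGram, Matrix.of_apply] at h2
      change Vᵀ i ⬝ᵥ _ = 0
      rw [Matrix.sub_mulVec, dotProduct_sub, h2, sub_self]
    exact Matrix.eq_zero_of_mulVec_eq_zero hVt.ne_zero h1
  have hMneg : ∀ w : ι → ℝ, w t = 0 → w ⬝ᵥ M *ᵥ w ≤ 0 := fun w hw => by
    obtain ⟨a, rfl⟩ : ∃ a, w = V *ᵥ a := ⟨V⁻¹ *ᵥ w, by
      rw [Matrix.mulVec_mulVec, Matrix.mul_nonsing_inv _ hV, Matrix.one_mulVec]⟩
    rw [dotProduct_mulVec_mulVec, ← hBM]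
    by_cases ha : a = 0
    · simp [ha]
    · exact (hneg a ha hw).le
  have hfeas : Feasible C M := by
    refine ⟨hMs, fun i => posSemidef_real_iff.2 ⟨(hC.isSymm i).sub hMs, fun z => ?_⟩⟩
    -- Split off the multiple of `vᵢ` that lands in the hyperplane. Since `(C i - M) vᵢ = 0`, only
    -- `-wᵀMw ≥ 0` survives in the form.
    obtain ⟨w, c, hwt, rfl⟩ : ∃ (w : ι → ℝ) (c : ℝ), w t = 0 ∧ z = w + c • Vᵀ i :=
      ⟨z - (z t / V t i) • Vᵀ i, z t / V t i, by simp [ht i], by simp⟩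
    have hsw : ∀ x, Vᵀ i ⬝ᵥ (C i - M) *ᵥ x = 0 := fun x => by
      rw [Matrix.dotProduct_mulVec, ← Matrix.mulVec_transpose, ((hC.isSymm i).sub hMs).eq, hker,
        zero_dotProduct]
    have := hMneg w hwt
    rw [Matrix.mulVec_add, Matrix.mulVec_smul, hker, smul_zero, add_zero, add_dotProduct,
      smul_dotProduct, hsw, smul_zero, add_zero, Matrix.sub_mulVec, dotProduct_sub,
      hC.isotropic i w hwt]
    linarith
  have htr : ∀ M' : Matrix ι ι ℝ, (Ωᵀ * M').trace = ∑ i, Vᵀ i ⬝ᵥ M' *ᵥ Vᵀ i := fun M' => by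
    rw [hΩs, ← hVΩ, Matrix.mul_assoc, Matrix.trace_mul_comm, Matrix.mul_assoc]
    rfl
  have hval : ∀ i, Vᵀ i ⬝ᵥ M *ᵥ Vᵀ i = crossGram C V V i i := fun i => by
    have h := congrArg (fun w => Vᵀ i ⬝ᵥ w) (hker i)
    simp only [Matrix.sub_mulVec, dotProduct_sub, dotProduct_zero, sub_eq_zero] at h
    exact h.symm
  refine ⟨⟨M, hfeas, ?_⟩, ?_⟩
  · rw [htr]
    exact Finset.sum_congr rfl fun i _ => (hval i).symm
  -- Weak duality, term by term: `vᵢᵀ M' vᵢ ≤ vᵢᵀ C i vᵢ`.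
  · rintro _ ⟨M', hM', rfl⟩
    rw [htr]
    refine Finset.sum_le_sum fun i _ => ?_
    have := (posSemidef_real_iff.1 (hM'.2 i)).2 (Vᵀ i)
    rw [Matrix.sub_mulVec, dotProduct_sub] at this
    simpa [crossGram] using sub_nonneg.1 this

/-! ### Smoothness of the value via the inverse function theorem -/

open scoped Matrix.Norms.Elementwise

theorem contDiff_matrix_apply {n : WithTop ℕ∞} (i j : ι) :
    ContDiff ℝ n fun V : Matrix ι ι ℝ => V i j :=
  contDiff_apply_apply ℝ ℝ i j

theorem contDiff_crossGram_apply (C : ι → Matrix ι ι ℝ) {n : WithTop ℕ∞} (i j : ι) :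
    ContDiff ℝ n fun V : Matrix ι ι ℝ => crossGram C V V i j := by
  simp only [crossGram, Matrix.of_apply, dotProduct, Matrix.mulVec, Matrix.transpose_apply]
  exact ContDiff.sum fun a _ => (contDiff_matrix_apply a i).mul
    (ContDiff.sum fun b _ => contDiff_const.mul (contDiff_matrix_apply b j))

theorem contDiff_stationarityMap (C : ι → Matrix ι ι ℝ) {n : WithTop ℕ∞} :
    ContDiff ℝ n (stationarityMap C) := by
  refine contDiff_pi.2 fun i => contDiff_pi.2 fun j => ?_
  refine ContDiff.add ?_ ((contDiff_crossGram_apply C i j).sub (contDiff_crossGram_apply C j i))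
  simp only [Matrix.mul_apply, Matrix.transpose_apply]
  exact ContDiff.sum fun a _ => (contDiff_matrix_apply i a).mul (contDiff_matrix_apply j a)

theorem hasDerivAt_add_smul_add_sq_smul {E : Type*} [NormedAddCommGroup E] [NormedSpace ℝ E]
    (a b c : E) : HasDerivAt (fun s : ℝ => a + s • b + s ^ 2 • c) b 0 := by
  have h₁ : HasDerivAt (fun s : ℝ => a + s • b) b 0 := by
    simpa using ((hasDerivAt_id (0 : ℝ)).smul_const b).const_add a
  have h₂ : HasDerivAt (fun s : ℝ => s ^ 2 • c) 0 0 := by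
    simpa using ((hasDerivAt_id (0 : ℝ)).pow 2).smul_const c
  have h := h₁.add h₂
  rw [add_zero] at h
  exact h

theorem fderiv_stationarityMap (C : ι → Matrix ι ι ℝ) (V D : Matrix ι ι ℝ) :
    fderiv ℝ (stationarityMap C) V D = stationarityDeriv C V D := by
  have hd : DifferentiableAt ℝ (stationarityMap C) V :=
    (contDiff_stationarityMap C (n := 1)).differentiable one_ne_zero V
  have h1 : HasDerivAt (fun s : ℝ => stationarityMap C (V + s • D))
      (fderiv ℝ (stationarityMap C) V D) 0 := by
    have hl : HasDerivAt (fun s : ℝ => V + s • D) D 0 := by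
      have h := hasDerivAt_add_smul_add_sq_smul V D 0
      simp only [smul_zero, add_zero] at h
      exact h
    exact HasFDerivAt.comp_hasDerivAt_of_eq (0 : ℝ) hd.hasFDerivAt hl (by simp)
  have h2 : HasDerivAt (fun s : ℝ => stationarityMap C (V + s • D))
      (stationarityDeriv C V D) 0 := by
    simp only [stationarityMap_add_smul]
    exact hasDerivAt_add_smul_add_sq_smul _ _ _
  exact h1.unique h2

/-- Near a positive definite `Ω`, the value of the semidefinite program is attained, and it is a
twice continuously differentiable function of the objective. -/
theorem NondegenerateFamily.exists_contDiffAt_value [DecidableEq ι] (hC : NondegenerateFamily C t)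
    (hΩ : Ω.PosDef) : ∃ p : Matrix ι ι ℝ → ℝ, ContDiffAt ℝ 2 p Ω ∧
      ∀ᶠ Ω' in 𝓝 Ω, Ω'.IsSymm → IsGreatest (feasibleValues C Ω') (p Ω') := by
  obtain ⟨M, V, hM, hVΩ, hker, hspan⟩ := hC.exists_factorization hΩ
  have hV : IsUnit V.det := by
    have h := (Matrix.isUnit_iff_isUnit_det _).1 hΩ.isUnit
    rw [← hVΩ, Matrix.det_mul] at h
    exact isUnit_of_mul_isUnit_left h
  have hBM : crossGram C V V = Vᵀ * M * V := crossGram_eq_of_ker hker V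
  have hB : (crossGram C V V).IsSymm := by
    simp [hBM, Matrix.IsSymm, hM.1.eq, Matrix.mul_assoc]
  have hΦ : stationarityMap C V = Ω := by
    rw [stationarityMap, hB.eq, sub_self, add_zero, hVΩ]
  have hinj := stationarityDeriv_injective hM hV hker hspan
  let L : Matrix ι ι ℝ ≃L[ℝ] Matrix ι ι ℝ :=
    (LinearEquiv.ofInjectiveEndo (stationarityDeriv C V) hinj).toContinuousLinearEquiv
  have hsmooth : ContDiffAt ℝ 2 (stationarityMap C) V := (contDiff_stationarityMap C).contDiffAt
  have hderiv : HasFDerivAt (stationarityMap C) (L : Matrix ι ι ℝ →L[ℝ] Matrix ι ι ℝ) V := by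
    have h := (hsmooth.differentiableAt two_ne_zero).hasFDerivAt
    convert! h using 1
    ext1 D
    exact (fderiv_stationarityMap C V D).symm
  let ψ := hsmooth.localInverse hderiv two_ne_zero
  have hψ : ContDiffAt ℝ 2 ψ Ω := hΦ ▸ hsmooth.to_localInverse hderiv two_ne_zero
  have hψΩ : ψ Ω = V := hΦ ▸ hsmooth.localInverse_apply_image hderiv two_ne_zero
  have hright : ∀ᶠ Ω' in 𝓝 Ω, stationarityMap C (ψ Ω') = Ω' :=
    hΦ ▸ (hsmooth.hasStrictFDerivAt' hderiv two_ne_zero).eventually_right_inverse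
  have hBcont : Continuous fun W : Matrix ι ι ℝ => crossGram C W W :=
    continuous_pi fun i => continuous_pi fun j =>
      (contDiff_crossGram_apply C (n := 0) i j).continuous
  have hdet' : ∀ᶠ W in 𝓝 V, IsUnit W.det := by
    have hc : Continuous fun W : Matrix ι ι ℝ => W.det := by fun_prop
    exact (hc.continuousAt.eventually_ne hV.ne_zero).mono fun W hW => hW.isUnit
  have ht' : ∀ᶠ W in 𝓝 V, ∀ i, W t i ≠ 0 := by
    refine Filter.eventually_all.2 fun i => ?_
    have hc : Continuous fun W : Matrix ι ι ℝ => W t i := by fun_prop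
    refine hc.continuousAt.eventually_ne fun h0 => ?_
    have hcol : Vᵀ i = 0 := hC.eq_zero_of_mem_ker hM h0 (hker i)
    exact hV.ne_zero (Matrix.det_eq_zero_of_column_eq_zero i fun j => congrFun hcol j)
  -- The hyperplane `(W a) t = 0` moves with `W`. On the unit sphere, points off it at `V` stay off
  -- it, and points on it keep the strict inequality.
  have hneg' : ∀ᶠ W in 𝓝 V, ∀ a, a ≠ 0 → (W *ᵥ a) t = 0 → a ⬝ᵥ crossGram C W W *ᵥ a < 0 := by
    have key : ∀ᶠ W in 𝓝 V, ∀ u ∈ Metric.sphere (0 : ι → ℝ) 1,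
        (W *ᵥ u) t = 0 → u ⬝ᵥ crossGram C W W *ᵥ u < 0 := by
      refine (isCompact_sphere (0 : ι → ℝ) 1).eventually_forall_of_forall_eventually fun u hu => ?_
      by_cases hut : (V *ᵥ u) t = 0
      · have hc : Continuous fun q : Matrix ι ι ℝ × (ι → ℝ) =>
            q.2 ⬝ᵥ crossGram C q.1 q.1 *ᵥ q.2 :=
          continuous_snd.dotProduct ((hBcont.comp continuous_fst).matrix_mulVec continuous_snd)
        have hu0 : u ≠ 0 := by
          rintro rfl
          simp at hu
        have hlt : u ⬝ᵥ crossGram C V V *ᵥ u < 0 := by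
          rw [hBM, ← dotProduct_mulVec_mulVec]
          exact hC.neg_of_apply_eq_zero hM hut fun h0 =>
            hu0 (Matrix.eq_zero_of_mulVec_eq_zero hV.ne_zero h0)
        have : ∀ᶠ q in 𝓝 (V, u), q.2 ⬝ᵥ crossGram C q.1 q.1 *ᵥ q.2 < 0 :=
          hc.continuousAt.eventually_lt_const hlt
        exact this.mono fun q hq _ => hq
      · have hc : Continuous fun q : Matrix ι ι ℝ × (ι → ℝ) => (q.1 *ᵥ q.2) t :=
          (continuous_apply t).comp (continuous_fst.matrix_mulVec continuous_snd)
        have : ∀ᶠ q in 𝓝 (V, u), (q.1 *ᵥ q.2) t ≠ 0 := hc.continuousAt.eventually_ne hut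
        exact this.mono fun q hq h0 => absurd h0 hq
    refine key.mono fun W hW a ha hat => ?_
    obtain ⟨u, hu, hau⟩ := exists_sphere_smul ha
    have hna : ‖a‖ ≠ 0 := norm_ne_zero_iff.2 ha
    rw [hau, Matrix.mulVec_smul, Pi.smul_apply, smul_eq_mul] at hat
    rw [hau, dotProduct_mulVec_smul_self]
    exact mul_neg_of_pos_of_neg (by positivity)
      (hW u hu ((mul_eq_zero.1 hat).resolve_left hna))
  refine ⟨fun Ω' => (crossGram C (ψ Ω') (ψ Ω')).trace, ?_, ?_⟩
  · have hP : ContDiff ℝ 2 fun W : Matrix ι ι ℝ => (crossGram C W W).trace :=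
      ContDiff.sum fun i _ => contDiff_crossGram_apply C i i
    exact hP.contDiffAt.comp Ω hψ
  · have htend : Filter.Tendsto ψ (𝓝 Ω) (𝓝 V) := by
      have := hψ.continuousAt.tendsto
      rwa [hψΩ] at this
    filter_upwards [hright, htend.eventually (hdet'.and (ht'.and hneg'))] with Ω' h1 h2 hs
    obtain ⟨h3, h4⟩ := eq_and_isSymm_of_stationarityMap_eq hs h1
    exact hC.isGreatest_trace_crossGram h2.1 h3 h4 h2.2.1 h2.2.2

end Abstract

/-! ### Calculus of twice differentiable maps -/

section TwiceDifferentiable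

variable {E F G : Type*} [NormedAddCommGroup E] [NormedSpace ℝ E]
  [NormedAddCommGroup F] [NormedSpace ℝ F] [NormedAddCommGroup G] [NormedSpace ℝ G]

/-- Twice differentiability of a vector-valued map. -/
def TwiceFDifferentiableAt (f : E → F) (x : E) : Prop :=
  (∀ᶠ y in 𝓝 x, DifferentiableAt ℝ f y) ∧ DifferentiableAt ℝ (fderiv ℝ f) x

theorem twiceFDifferentiableAt_of_contDiffAt {f : E → F} {x : E} (hf : ContDiffAt ℝ 2 f x) :
    TwiceFDifferentiableAt f x :=
  ⟨(hf.eventually (by simp)).mono fun _ hy => hy.differentiableAt two_ne_zero,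
    (hf.fderiv_right (m := 1) (by norm_num)).differentiableAt one_ne_zero⟩

theorem TwiceFDifferentiableAt.congr {f g : E → F} {x : E} (hf : TwiceFDifferentiableAt f x)
    (h : g =ᶠ[𝓝 x] f) : TwiceFDifferentiableAt g x :=
  ⟨(h.eventuallyEq_nhds.and hf.1).mono fun _ hy => hy.2.congr_of_eventuallyEq hy.1,
    hf.2.congr_of_eventuallyEq h.fderiv⟩

theorem TwiceFDifferentiableAt.comp {g : F → G} {f : E → F} {x : E}
    (hg : TwiceFDifferentiableAt g (f x)) (hf : TwiceFDifferentiableAt f x) :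
    TwiceFDifferentiableAt (fun y => g (f y)) x := by
  have hfx : DifferentiableAt ℝ f x := hf.1.self_of_nhds
  have hev := (hfx.continuousAt.eventually hg.1).and hf.1
  refine ⟨hev.mono fun y hy => hy.1.comp y hy.2, ?_⟩
  have heq : fderiv ℝ (fun y => g (f y)) =ᶠ[𝓝 x]
      fun y => (fderiv ℝ g (f y)).comp (fderiv ℝ f y) :=
    hev.mono fun y hy => fderiv_comp y hy.1 hy.2
  exact ((hg.2.comp x hfx).clm_comp hf.2).congr_of_eventuallyEq heq

theorem TwiceFDifferentiableAt.add {f g : E → F} {x : E} (hf : TwiceFDifferentiableAt f x)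
    (hg : TwiceFDifferentiableAt g x) : TwiceFDifferentiableAt (fun y => f y + g y) x := by
  refine ⟨(hf.1.and hg.1).mono fun y hy => hy.1.add hy.2, ?_⟩
  have heq : fderiv ℝ (fun y => f y + g y) =ᶠ[𝓝 x] fun y => fderiv ℝ f y + fderiv ℝ g y :=
    (hf.1.and hg.1).mono fun y hy => fderiv_add hy.1 hy.2
  exact (hf.2.add hg.2).congr_of_eventuallyEq heq

theorem twiceFDifferentiableAt_const (c : F) (x : E) :
    TwiceFDifferentiableAt (fun _ : E => c) x :=
  twiceFDifferentiableAt_of_contDiffAt contDiffAt_const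

theorem TwiceFDifferentiableAt.sum {α : Type*} {s : Finset α} {f : α → E → F} {x : E}
    (hf : ∀ a, TwiceFDifferentiableAt (f a) x) :
    TwiceFDifferentiableAt (fun y => ∑ a ∈ s, f a y) x := by
  classical
  induction s using Finset.induction_on with
  | empty => simpa using twiceFDifferentiableAt_const 0 x
  | insert a s ha ih => simpa [Finset.sum_insert ha] using (hf a).add ih

theorem TwiceFDifferentiableAt.mul {f g : E → ℝ} {x : E} (hf : TwiceFDifferentiableAt f x)
    (hg : TwiceFDifferentiableAt g x) : TwiceFDifferentiableAt (fun y => f y * g y) x := by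
  refine ⟨(hf.1.and hg.1).mono fun y hy => hy.1.mul hy.2, ?_⟩
  have heq : fderiv ℝ (fun y => f y * g y) =ᶠ[𝓝 x]
      fun y => f y • fderiv ℝ g y + g y • fderiv ℝ f y :=
    (hf.1.and hg.1).mono fun y hy => fderiv_mul hy.1 hy.2
  exact ((hf.1.self_of_nhds.smul hg.2).add (hg.1.self_of_nhds.smul hf.2)).congr_of_eventuallyEq heq

theorem TwiceFDifferentiableAt.sub {f g : E → ℝ} {x : E} (hf : TwiceFDifferentiableAt f x)
    (hg : TwiceFDifferentiableAt g x) : TwiceFDifferentiableAt (fun y => f y - g y) x := by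
  simpa [sub_eq_add_neg] using hf.add ((twiceFDifferentiableAt_const (-1) x).mul hg)

theorem TwiceFDifferentiableAt.pi {α : Type*} [Fintype α] {f : E → α → F} {x : E}
    (hf : ∀ a, TwiceFDifferentiableAt (fun y => f y a) x) : TwiceFDifferentiableAt f x := by
  classical
  have h : TwiceFDifferentiableAt
      (fun y => ∑ a, ContinuousLinearMap.single ℝ (fun _ : α => F) a (f y a)) x :=
    .sum fun a => (twiceFDifferentiableAt_of_contDiffAt
      (ContinuousLinearMap.single ℝ (fun _ : α => F) a).contDiff.contDiffAt).comp (hf a)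
  refine h.congr (.of_forall fun y => ?_)
  simp [Finset.univ_sum_single]

end TwiceDifferentiable

/-! ### The moment matrix and the concrete constraints -/

/-- At `(ξ, τ)` the form is `ξᵀSξ + (μ·ξ + τ)²`. -/
theorem posDef_momentBlocks {α : Type*} [Fintype α] {S : Matrix α α ℝ} (hS : S.PosDef)
    (μ : α → ℝ) :
    (Matrix.fromBlocks (S + Matrix.vecMulVec μ μ) (Matrix.replicateCol Unit μ)
      (Matrix.replicateRow Unit μ) 1).PosDef := by
  have hSs := (posSemidef_real_iff.1 hS.posSemidef).1
  refine .of_dotProduct_mulVec_pos ?_ fun {z} hz => ?_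
  · rw [Matrix.IsHermitian, Matrix.conjTranspose_eq_transpose_of_trivial,
      Matrix.fromBlocks_transpose]
    simp [hSs.eq, Matrix.transpose_vecMulVec]
  · obtain ⟨ξ, τ, rfl⟩ : ∃ (ξ : α → ℝ) (τ : ℝ), z = Sum.elim ξ fun _ => τ :=
      ⟨z ∘ Sum.inl, z (Sum.inr ()), by ext (i | i) <;> rfl⟩
    have heq : star (Sum.elim ξ fun _ : Unit => τ) ⬝ᵥ Matrix.fromBlocks (S + Matrix.vecMulVec μ μ)
        (Matrix.replicateCol Unit μ) (Matrix.replicateRow Unit μ) 1 *ᵥ (Sum.elim ξ fun _ => τ) =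
        ξ ⬝ᵥ S *ᵥ ξ + (μ ⬝ᵥ ξ + τ) ^ 2 := by
      have h1 : Matrix.replicateCol Unit μ *ᵥ (fun _ : Unit => τ) = τ • μ := by
        ext i; simp [Matrix.mulVec, dotProduct, mul_comm]
      have h2 : Matrix.replicateRow Unit μ *ᵥ ξ = fun _ => μ ⬝ᵥ ξ := by
        ext i; simp [Matrix.mulVec, dotProduct]
      rw [star_trivial, Matrix.fromBlocks_mulVec, sumElim_dotProduct_sumElim]
      simp only [Sum.elim_comp_inl, Sum.elim_comp_inr, h1, h2, Matrix.add_mulVec,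
        Matrix.vecMulVec_mulVec, dotProduct_add, Matrix.one_mulVec]
      have h3 : ∀ w : Unit → ℝ, (fun _ => τ) ⬝ᵥ w = τ * w () := fun w => by simp [dotProduct]
      simp [h3, dotProduct_comm ξ μ]
      ring
    rw [heq]
    by_cases hξ : ξ = 0
    · have hτ : τ ≠ 0 := by
        rintro rfl
        exact hz (by ext (i | i) <;> simp [hξ])
      subst hξ
      simp
      positivity
    · have := hS.dotProduct_mulVec_pos hξ
      rw [star_trivial] at this
      positivity

section Constraints

variable {k : ℕ} (y : ℝ)

/-- The constraint matrices indexed by the rows of the moment matrix, with `C 0` last. -/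
noncomputable def constraintFamily (k : ℕ) (y : ℝ) :
    Fin k ⊕ Unit → Matrix (Fin k ⊕ Unit) (Fin k ⊕ Unit) ℝ :=
  Sum.elim (fun i => constraintMatrix k y i.succ) fun _ => constraintMatrix k y 0

theorem constraintMatrix_zero : constraintMatrix k y 0 = 0 := rfl

theorem constraintMatrix_succ_mulVec (i : Fin k) (z : Fin k ⊕ Unit → ℝ) :
    constraintMatrix k y i.succ *ᵥ z =
      Sum.elim ((z (Sum.inr ()) / 2) • Pi.single i 1)
        fun _ => z (Sum.inl i) / 2 - y * z (Sum.inr ()) := by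
  ext (a | a)
  · simp [constraintMatrix, Matrix.mulVec, dotProduct]
    ring
  · simp [constraintMatrix, Matrix.mulVec, dotProduct, Pi.single_apply]
    ring

theorem dotProduct_constraintMatrix_succ_mulVec (i : Fin k) (z : Fin k ⊕ Unit → ℝ) :
    z ⬝ᵥ constraintMatrix k y i.succ *ᵥ z =
      z (Sum.inr ()) * z (Sum.inl i) - y * z (Sum.inr ()) ^ 2 := by
  rw [constraintMatrix_succ_mulVec]
  simp [dotProduct, Pi.single_apply]
  ring

theorem constraintMatrix_isSymm (i : Fin (k + 1)) : (constraintMatrix k y i).IsSymm := by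
  refine Fin.cases ?_ (fun i => ?_) i
  · exact Matrix.isSymm_zero
  · simp only [constraintMatrix, Fin.cons_succ, Matrix.IsSymm, Matrix.fromBlocks_transpose]
    rfl

theorem feasible_constraintFamily_iff {M : Matrix (Fin k ⊕ Unit) (Fin k ⊕ Unit) ℝ} :
    Feasible (constraintFamily k y) M ↔
      M.IsSymm ∧ ∀ i, (constraintMatrix k y i - M).PosSemidef := by
  simp [Feasible, constraintFamily, Fin.forall_fin_succ, and_comm]

theorem nondegenerateFamily_constraintFamily (k : ℕ) (y : ℝ) :
    NondegenerateFamily (constraintFamily k y) (Sum.inr ()) where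
  isSymm := by
    rintro (i | i)
    · exact constraintMatrix_isSymm y i.succ
    · exact constraintMatrix_isSymm y 0
  isotropic := by
    rintro (i | i) z hz
    · simp [constraintFamily, dotProduct_constraintMatrix_succ_mulVec, hz]
    · simp [constraintFamily, constraintMatrix_zero]
  separating z hz h := by
    ext (i | i)
    · have := congrFun (h (Sum.inl i) (Sum.inr ())) (Sum.inr ())
      simpa [constraintFamily, constraintMatrix_zero, constraintMatrix_succ_mulVec, hz] using this
    · exact hz
  exists_feasible := by
    -- With `τ` the last coordinate, `τ zᵢ - y τ² + (1 + |y|)‖z‖² ≥ 0`: the `|y|` absorbs `y τ²`,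
    -- the `1` absorbs the cross term.
    refine ⟨-((1 + |y|) • 1), (feasible_constraintFamily_iff y).2
      ⟨(Matrix.isSymm_one.smul _).neg, fun i => posSemidef_real_iff.2
        ⟨(constraintMatrix_isSymm y i).sub (Matrix.isSymm_one.smul _).neg, fun z => ?_⟩⟩⟩
    have hz : ∀ a, z a ^ 2 ≤ z ⬝ᵥ z := fun a => by
      simpa [dotProduct, sq] using
        Finset.single_le_sum (f := fun a => z a * z a) (fun a _ => mul_self_nonneg _)
          (Finset.mem_univ a)
    have h0 : 0 ≤ z ⬝ᵥ z :=
      Finset.sum_nonneg fun a _ => mul_self_nonneg (z a)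
    rw [sub_neg_eq_add, Matrix.add_mulVec, Matrix.smul_mulVec, Matrix.one_mulVec, dotProduct_add,
      dotProduct_smul, smul_eq_mul]
    refine Fin.cases ?_ (fun i => ?_) i
    · rw [constraintMatrix_zero, Matrix.zero_mulVec, dotProduct_zero, zero_add]
      positivity
    · rw [dotProduct_constraintMatrix_succ_mulVec]
      have h1 := hz (Sum.inl i)
      have h2 := hz (Sum.inr ())
      have h3 : y * z (Sum.inr ()) ^ 2 ≤ |y| * (z ⬝ᵥ z) :=
        mul_le_mul (le_abs_self y) h2 (sq_nonneg _) (abs_nonneg y)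
      nlinarith [sq_nonneg (z (Sum.inr ()) + z (Sum.inl i))]

theorem feasibleValues_constraintFamily (Ω : Matrix (Fin k ⊕ Unit) (Fin k ⊕ Unit) ℝ) :
    feasibleValues (constraintFamily k y) Ω = sdpValues y Ω := by
  ext v
  simp only [feasibleValues, sdpValues, feasible_constraintFamily_iff, and_assoc]

end Constraints

/-! ### Differentiability of the posterior and conclusion -/

section Posterior

open scoped Matrix.Norms.Elementwise

variable {n k l : ℕ} (gp : GPPrior n) (Xd : Batch l n) (yd : Fin l → ℝ)

theorem GPPrior.kernel_comm (x z : EuclideanSpace ℝ (Fin n)) : gp.kernel x z = gp.kernel z x := by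
  have h := (posSemidef_real_iff.1 (gp.posSemidef_gram 2 ![x, z])).1.apply 1 0
  simpa [covMatrix] using h

theorem transpose_covMatrix {a b : ℕ} (X : Batch a n) (Z : Batch b n) :
    (covMatrix gp.kernel X Z)ᵀ = covMatrix gp.kernel Z X := by
  ext i j
  exact gp.kernel_comm _ _

theorem postCov_isSymm (X : Batch k n) : (postCov gp Xd X).IsSymm := by
  simp [Matrix.IsSymm, postCov, transpose_covMatrix, Matrix.transpose_nonsing_inv,
    Matrix.mul_assoc]

theorem momentMatrix_isSymm (X : Batch k n) : (momentMatrix gp Xd yd X).IsSymm := by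
  simp [Matrix.IsSymm, momentMatrix, Matrix.fromBlocks_transpose, (postCov_isSymm gp Xd X).eq,
    Matrix.transpose_vecMulVec]

variable {gp Xd} {X : Batch k n}

theorem twiceFDifferentiableAt_kernel_data
    (hker_data : ∀ i j, TwiceDifferentiableAt (Function.uncurry gp.kernel) (X i, Xd j))
    (i : Fin k) (j : Fin l) :
    TwiceFDifferentiableAt (fun Z : Batch k n => gp.kernel (Z i) (Xd j)) X :=
  TwiceFDifferentiableAt.comp (g := Function.uncurry gp.kernel)
    (f := fun Z : Batch k n => (Z i, Xd j)) (hker_data i j)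
    (twiceFDifferentiableAt_of_contDiffAt (by fun_prop))

theorem twiceFDifferentiableAt_postMean
    (hmean : ∀ i, TwiceDifferentiableAt gp.mean (X i))
    (hker_data : ∀ i j, TwiceDifferentiableAt (Function.uncurry gp.kernel) (X i, Xd j))
    (i : Fin k) : TwiceFDifferentiableAt (fun Z : Batch k n => postMean gp Xd yd Z i) X := by
  simp only [postMean, Pi.add_apply, Matrix.mulVec, dotProduct, Matrix.mul_apply, covMatrix,
    Matrix.of_apply]
  refine .add ?_ (.sum fun j => .mul (.sum fun a => .mul ?_ (twiceFDifferentiableAt_const _ _))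
    (twiceFDifferentiableAt_const _ _))
  · exact TwiceFDifferentiableAt.comp (g := gp.mean) (f := fun Z : Batch k n => Z i) (hmean i)
      (twiceFDifferentiableAt_of_contDiffAt (by fun_prop))
  · exact twiceFDifferentiableAt_kernel_data hker_data i a

theorem twiceFDifferentiableAt_postCov
    (hker : ∀ i j, TwiceDifferentiableAt (Function.uncurry gp.kernel) (X i, X j))
    (hker_data : ∀ i j, TwiceDifferentiableAt (Function.uncurry gp.kernel) (X i, Xd j))
    (i j : Fin k) : TwiceFDifferentiableAt (fun Z : Batch k n => postCov gp Xd Z i j) X := by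
  simp only [postCov, Matrix.sub_apply, Matrix.mul_apply]
  refine .sub ?_ (.sum fun b => .mul (.sum fun a => .mul ?_ (twiceFDifferentiableAt_const _ _)) ?_)
  · exact TwiceFDifferentiableAt.comp (g := Function.uncurry gp.kernel)
      (f := fun Z : Batch k n => (Z i, Z j)) (hker i j)
      (twiceFDifferentiableAt_of_contDiffAt (by fun_prop))
  · exact twiceFDifferentiableAt_kernel_data hker_data i a
  -- Differentiability is given only at `(X i, Xd j)`, so kernel symmetry swaps the arguments of
  -- `K(Xd, X)`.
  · simp only [covMatrix, Matrix.of_apply, gp.kernel_comm (Xd _)]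
    exact twiceFDifferentiableAt_kernel_data hker_data j b

theorem twiceFDifferentiableAt_momentMatrix
    (hmean : ∀ i, TwiceDifferentiableAt gp.mean (X i))
    (hker : ∀ i j, TwiceDifferentiableAt (Function.uncurry gp.kernel) (X i, X j))
    (hker_data : ∀ i j, TwiceDifferentiableAt (Function.uncurry gp.kernel) (X i, Xd j)) :
    TwiceFDifferentiableAt (fun Z : Batch k n => momentMatrix gp Xd yd Z) X := by
  have hμ := twiceFDifferentiableAt_postMean yd hmean hker_data
  refine TwiceFDifferentiableAt.pi fun r => TwiceFDifferentiableAt.pi fun c => ?_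
  rcases r with i | i <;> rcases c with j | j
  · exact (twiceFDifferentiableAt_postCov hker hker_data i j).add ((hμ i).mul (hμ j))
  · exact hμ i
  · exact hμ j
  · exact twiceFDifferentiableAt_const _ _

theorem posDef_momentMatrix (hcov : (postCov gp Xd X).PosDef) :
    (momentMatrix gp Xd yd X).PosDef :=
  posDef_momentBlocks hcov (postMean gp Xd yd X)

theorem isLUB_and_twiceDifferentiableAt_oei [NeZero l]
    (hcov : (postCov gp Xd X).PosDef)
    (hmean : ∀ i, TwiceDifferentiableAt gp.mean (X i))
    (hker : ∀ i j, TwiceDifferentiableAt (Function.uncurry gp.kernel) (X i, X j))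
    (hker_data : ∀ i j, TwiceDifferentiableAt (Function.uncurry gp.kernel) (X i, Xd j)) :
    IsLUB (sdpValues (bestValue yd) (momentMatrix gp Xd yd X)) (oei gp Xd yd X) ∧
      TwiceDifferentiableAt (fun Z : Batch k n => oei gp Xd yd Z) X := by
  obtain ⟨p, hp, hval⟩ := (nondegenerateFamily_constraintFamily k
    (bestValue yd)).exists_contDiffAt_value
      (posDef_momentMatrix yd hcov)
  have hΩ := twiceFDifferentiableAt_momentMatrix yd hmean hker hker_data
  have hgreatest : ∀ᶠ Z in 𝓝 X, IsGreatest
      (sdpValues (bestValue yd) (momentMatrix gp Xd yd Z))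
      (p (momentMatrix gp Xd yd Z)) := by
    filter_upwards [hΩ.1.self_of_nhds.continuousAt.eventually hval] with Z hZ
    rw [← feasibleValues_constraintFamily]
    exact hZ (momentMatrix_isSymm gp Xd yd Z)
  have heq : ∀ᶠ Z in 𝓝 X, oei gp Xd yd Z = p (momentMatrix gp Xd yd Z) :=
    hgreatest.mono fun Z hZ => hZ.csSup_eq
  refine ⟨?_, ?_⟩
  · rw [heq.self_of_nhds]
    exact hgreatest.self_of_nhds.isLUB
  · exact ((twiceFDifferentiableAt_of_contDiffAt hp).comp hΩ).congr heq

end Posterior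

end OEI

theorem mainTheorem4 {n k l : ℕ} [NeZero l] (gp : OEI.GPPrior n)
    (Xd : OEI.Batch l n) (yd : Fin l → ℝ)
    (hK : IsUnit (OEI.covMatrix gp.kernel Xd Xd).det)
    (X : OEI.Batch k n)
    (hcov : (OEI.postCov gp Xd X).PosDef)
    (hmean : ∀ i, OEI.TwiceDifferentiableAt gp.mean (X i))
    (hker : ∀ i j, OEI.TwiceDifferentiableAt (Function.uncurry gp.kernel) (X i, X j))
    (hker_data : ∀ i j, OEI.TwiceDifferentiableAt (Function.uncurry gp.kernel) (X i, Xd j)) :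
    IsLUB (OEI.sdpValues (OEI.bestValue yd) (OEI.momentMatrix gp Xd yd X))
        (OEI.oei gp Xd yd X) ∧
      OEI.TwiceDifferentiableAt (fun Z : OEI.Batch k n => OEI.oei gp Xd yd Z) X := by
  exact OEI.isLUB_and_twiceDifferentiableAt_oei yd hcov hmean hker hker_data
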